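/- A linear order is *Aronszajn* if it has cardinality $\aleph_1$, no uncountable suborder of it is isomorphic to a set of real numbers, and it embeds neither $\omega_1$ nor $\omega_1^*$. A *Countryman line* is an Aronszajn line $C$ such that $C\times C$, with the coordinatewise partial order, is a union of countably many chains. It is *minimal* if every Aronszajn line contains an isomorphic copy of $C$ or of its reverse $C^*$. For order types write $\phi\leqq\psi$ if $\phi$ embeds into $\psi$, and $\phi\equiv\psi$ if $\phi\leqq\psi$ and $\psi\leqq\phi$. A type $\phi$ is *algebraically indecomposable* if whenever $\phi\equiv\psi_1+\psi_2$, then $\phi\leqq\psi_1$ or $\phi\leqq\psi_2$. For a linear order $L$, an ordered sum $\sum_{x\in L}\phi_x$ of order types is an *$L$-shuffle* if for every $z\in L$ and all $u<v$ in $L$ there is $z'\in L$ with $u<z'<v$ and $\phi_z\leqq\phi_{z'}$. A sum $\phi_0+\phi_1+\phi_2+\cdots$ over $\omega$ (respectively $\cdots+\phi_2+\phi_1+\phi_0$ over $\omega^*$) is *unbounded* if for every $n$ there is $m>n$ with $\phi_n\leqq\phi_m$. Fix a minimal Countryman line $C$. Let $\mathcal H_0=\{0,1\}$ (the types of the empty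 order and of the one-point order). For an ordinal $\beta>0$ let $\mathcal H_\beta$ be the class of all $L$-shuffles with $L\in\{\mathbb Q,C,C^*\}$, and all unbounded sums over $L\in\{\omega,\omega^*\}$, of families of members of $\bigcup_{\alpha<\beta}\mathcal H_\alpha$. Let $\mathcal H=\bigcup_\beta\mathcal H_\beta$. **Proposition.** Every $\phi\in\mathcal H$ is algebraically indecomposable. -/

import Mathlib

universe u v

noncomputable section

/-- The ordered sum `∑_{x ∈ L} φ x` of a family of order types: the type of the disjoint union of
realizations of the `φ x`, where points are compared by their index first and points with the same
index are compared inside the corresponding summand. -/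
def orderedSum {L : Type v} [LinearOrder L] (φ : L → OrderType.{u}) : OrderType.{max u v} :=
  OrderType.type (Lex (Sigma fun x : L => (φ x).ToType))

/-- Biembeddability `φ ≡ ψ` of order types (`≤` on `OrderType` is embeddability). -/
def OrderBiembeddable (φ ψ : OrderType.{u}) : Prop :=
  φ ≤ ψ ∧ ψ ≤ φ

/-- Algebraic indecomposability. -/
def AlgIndecomposable (φ : OrderType.{u}) : Prop :=
  ∀ ψ₁ ψ₂ : OrderType.{u}, OrderBiembeddable φ (ψ₁ + ψ₂) → φ ≤ ψ₁ ∨ φ ≤ ψ₂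

/-- `A` is an Aronszajn line: it has size `ℵ₁`, no uncountable suborder of it is isomorphic to a
set of reals, and it embeds neither `ω₁` nor its reverse. -/
structure IsAronszajnLine (A : Type u) [LinearOrder A] : Prop where
  card_eq : Cardinal.mk A = Cardinal.aleph 1
  countable_of_real : ∀ S : Set A, Nonempty (S ↪o ℝ) → S.Countable
  no_omega_one : IsEmpty ((Ordinal.omega.{u} 1).ToType ↪o A)
  no_omega_one_dual : IsEmpty (((Ordinal.omega.{u} 1).ToType)ᵒᵈ ↪o A)

/-- `C` is a Countryman line: an Aronszajn line whose square, with the coordinatewise partial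
order, is a union of countably many chains. -/
structure IsCountrymanLine (C : Type u) [LinearOrder C] : Prop where
  aronszajn : IsAronszajnLine C
  square : ∃ K : ℕ → Set (C × C), (∀ n, IsChain (· ≤ ·) (K n)) ∧ (⋃ n, K n) = Set.univ

/-- `C` is a minimal Countryman line: a Countryman line such that every Aronszajn line contains
a copy of `C` or of its reverse. -/
structure IsMinimalCountrymanLine (C : Type u) [LinearOrder C] : Prop where
  countryman : IsCountrymanLine C
  minimal : ∀ (A : Type u) [LinearOrder A], IsAronszajnLine A →
    Nonempty (C ↪o A) ∨ Nonempty (Cᵒᵈ ↪o A)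

/-- The sum of the family `φ` over `L` is an `L`-shuffle: every `φ z` embeds into some `φ z'`
with `z'` in any prescribed open interval `(a, b)`, `a < b`, of `L`. -/
def IsShuffle {L : Type v} [LinearOrder L] (φ : L → OrderType.{u}) : Prop :=
  ∀ z a b : L, a < b → ∃ z' ∈ Set.Ioo a b, φ z ≤ φ z'

/-- The unboundedness condition on a sequence of types. -/
def IsUnboundedSeq (φ : ℕ → OrderType.{u}) : Prop :=
  ∀ n, ∃ m, n < m ∧ φ n ≤ φ m

/-- The stages `H_β` of the class `H` (for a given line `C`): `H_0 = {0, 1}`, and for `β > 0` the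
members of `H_β` are the `L`-shuffles, `L ∈ {ℚ, C, C*}`, and the unbounded `ω`- and `ω*`-sums, of
members of `⋃_{α < β} H_α`. (`r x` is the stage from which the summand `φ x` is taken. The sum
over `ω*` is `⋯ + φ 2 + φ 1 + φ 0`.) -/
inductive HStage (C : Type u) [LinearOrder C] : Ordinal.{u} → OrderType.{u} → Prop
  | zero : HStage C 0 (OrderType.type PEmpty.{u + 1})
  | one : HStage C 0 (OrderType.type PUnit.{u + 1})
  | shuffleRat (β : Ordinal.{u}) (φ : ℚ → OrderType.{u}) (r : ℚ → Ordinal.{u})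
      (hr : ∀ x, r x < β) (hφ : ∀ x, HStage C (r x) (φ x)) (hs : IsShuffle φ) :
      HStage C β (orderedSum φ)
  | shuffleC (β : Ordinal.{u}) (φ : C → OrderType.{u}) (r : C → Ordinal.{u})
      (hr : ∀ x, r x < β) (hφ : ∀ x, HStage C (r x) (φ x)) (hs : IsShuffle φ) :
      HStage C β (orderedSum φ)
  | shuffleCDual (β : Ordinal.{u}) (φ : Cᵒᵈ → OrderType.{u}) (r : Cᵒᵈ → Ordinal.{u})
      (hr : ∀ x, r x < β) (hφ : ∀ x, HStage C (r x) (φ x)) (hs : IsShuffle φ) :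
      HStage C β (orderedSum φ)
  | sumOmega (β : Ordinal.{u}) (φ : ℕ → OrderType.{u}) (r : ℕ → Ordinal.{u})
      (hr : ∀ n, r n < β) (hφ : ∀ n, HStage C (r n) (φ n)) (hu : IsUnboundedSeq φ) :
      HStage C β (orderedSum φ)
  | sumOmegaDual (β : Ordinal.{u}) (φ : ℕ → OrderType.{u}) (r : ℕ → Ordinal.{u})
      (hr : ∀ n, r n < β) (hφ : ∀ n, HStage C (r n) (φ n)) (hu : IsUnboundedSeq φ) :
      HStage C β (orderedSum fun k : ℕᵒᵈ => φ (OrderDual.ofDual k))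

/-- The class `H`, the union of all its stages. -/
def classH (C : Type u) [LinearOrder C] : Set OrderType.{u} :=
  {φ | ∃ β : Ordinal.{u}, HStage C β φ}

end

open Set Cardinal

/-! Only the outermost sum matters; no induction on the stages is needed. An embedding of
`orderedSum φ` into `ψ₁ + ψ₂` cuts the index line `L`: the summands over a lower set `S` go into
`ψ₁`, those over an upper set `T` into `ψ₂`, and at most one summand is split. If `L` maps
increasingly into `S` or into `T` without decreasing the types (`CutAbsorbing`), the whole sum
re-embeds over that part, hence into `ψ₁` or `ψ₂`. For shuffles it suffices that `S` or `T` contains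
an `L`-ordered family of nonoverlapping intervals, since the shuffle condition finds a suitable
index inside each. Such families come from universality of dense orders for `ℚ`, and from the chains
covering the square together with minimality for `C`. -/

theorem OrderType.le_iff_nonempty_toType {φ ψ : OrderType.{u}} :
    φ ≤ ψ ↔ Nonempty (φ.ToType ↪o ψ.ToType) := by
  rw [← OrderType.type_le_type_iff, OrderType.type_toType, OrderType.type_toType]

/-! ### Reduction to cuts of the index line -/

/-- A family of types over `L` such that, however `L` is cut (up to one point) into a lower and an
upper part, `L` maps increasingly into one of the two parts without decreasing the types. -/
def CutAbsorbing {L : Type v} [LinearOrder L] (φ : L → OrderType.{u}) : Prop :=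
  ∀ S T : Set L, IsLowerSet S → IsUpperSet T → (S ∪ T)ᶜ.Subsingleton →
    ∃ e : L → L, StrictMono e ∧ (∀ x, φ x ≤ φ (e x)) ∧ ((∀ x, e x ∈ S) ∨ ∀ x, e x ∈ T)

/-- However `L` is cut (up to one point) into a lower and an upper part, one of the parts contains
an increasing copy of `L` made of nondegenerate, nonoverlapping intervals. -/
def CutContainsIntervals (L : Type v) [LinearOrder L] : Prop :=
  ∀ S T : Set L, IsLowerSet S → IsUpperSet T → (S ∪ T)ᶜ.Subsingleton →
    ∃ a b : L → L, (∀ x, a x < b x) ∧ (∀ x y, x < y → b x ≤ a y) ∧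
      ((∀ x, a x ∈ S ∧ b x ∈ S) ∨ ∀ x, a x ∈ T ∧ b x ∈ T)

theorem IsShuffle.cutAbsorbing {L : Type v} [LinearOrder L] {φ : L → OrderType.{u}}
    (hφ : IsShuffle φ) (hL : CutContainsIntervals L) : CutAbsorbing φ := by
  intro S T hS hT hST
  obtain ⟨a, b, hab, hba, h⟩ := hL S T hS hT hST
  choose e he hle using fun x => hφ x (a x) (b x) (hab x)
  refine ⟨e, fun x y hxy => (he x).2.trans_le ((hba x y hxy).trans (he y).1.le), hle, ?_⟩
  exact h.imp (fun h x => hS (he x).2.le (h x).2) (fun h x => hT (he x).1.le (h x).1)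

theorem Sigma.Lex.map_strictMono {L : Type v} [LinearOrder L] {A B : L → Type u}
    [∀ x, LinearOrder (A x)] [∀ x, LinearOrder (B x)] {e : L → L} (he : StrictMono e)
    (g : ∀ x, A x ↪o B (e x)) :
    StrictMono fun p : Σₗ x, A x => (toLex ⟨e (ofLex p).1, g _ (ofLex p).2⟩ : Σₗ x, B x) := by
  intro p q hpq
  obtain ⟨x, p⟩ := p
  obtain ⟨y, q⟩ := q
  cases hpq with
  | left _ _ h => exact Sigma.Lex.left _ _ (he h)
  | right _ _ h => exact Sigma.Lex.right _ _ ((g x).strictMono h)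

theorem OrderType.le_of_strictMono_sum_inl {P α β : Type u} [LinearOrder P] [LinearOrder α]
    [LinearOrder β] {f : P → α ⊕ₗ β} (hf : StrictMono f)
    (h : ∀ p, ∃ a, f p = toLex (Sum.inl a)) : OrderType.type P ≤ OrderType.type α := by
  choose g hg using h
  refine OrderType.type_le_type (OrderEmbedding.ofStrictMono g fun p q hpq => ?_)
  simpa [hg, Sum.Lex.inl_lt_inl_iff] using hf hpq

theorem OrderType.le_of_strictMono_sum_inr {P α β : Type u} [LinearOrder P] [LinearOrder α]
    [LinearOrder β] {f : P → α ⊕ₗ β} (hf : StrictMono f)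
    (h : ∀ p, ∃ b, f p = toLex (Sum.inr b)) : OrderType.type P ≤ OrderType.type β := by
  choose g hg using h
  refine OrderType.type_le_type (OrderEmbedding.ofStrictMono g fun p q hpq => ?_)
  simpa [hg, Sum.Lex.inr_lt_inr_iff] using hf hpq

theorem CutAbsorbing.algIndecomposable {L : Type v} [LinearOrder L] {φ : L → OrderType.{u}}
    (hφ : CutAbsorbing φ) : AlgIndecomposable (orderedSum φ) := by
  intro ψ₁ ψ₂ ⟨h, _⟩
  rw [← OrderType.type_toType ψ₁, ← OrderType.type_toType ψ₂] at h ⊢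
  rw [← OrderType.type_lex_sum] at h
  obtain ⟨f⟩ := OrderType.type_le_type_iff.1 h
  have dich : ∀ p, (∃ a, f p = toLex (Sum.inl a)) ∨ ∃ b, f p = toLex (Sum.inr b) := by
    intro p
    rcases hp : ofLex (f p) with a | b
    · exact Or.inl ⟨a, hp⟩
    · exact Or.inr ⟨b, hp⟩
  have mono : ∀ p q a b, f p = toLex (Sum.inl a) → f q = toLex (Sum.inr b) → p < q := by
    intro p q a b hp hq
    rw [← f.lt_iff_lt, hp, hq]
    exact Sum.Lex.inl_lt_inr a b
  have fst_le : ∀ p q : Σₗ x, (φ x).ToType, p < q → (ofLex p).1 ≤ (ofLex q).1 := by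
    intro p q hpq
    rcases Sigma.Lex.lt_def.1 hpq with h | ⟨h, _⟩
    · exact h.le
    · exact h.le
  let S : Set L := {x | ∀ p : Σₗ x, (φ x).ToType, (ofLex p).1 ≤ x → ∃ a, f p = toLex (Sum.inl a)}
  let T : Set L := {x | ∀ p : Σₗ x, (φ x).ToType, x ≤ (ofLex p).1 → ∃ b, f p = toLex (Sum.inr b)}
  have hS : IsLowerSet S := fun x y hyx hx p hp => hx p (hp.trans hyx)
  have hT : IsUpperSet T := fun x y hyx hx p hp => hx p (hyx.trans hp)
  -- A point of index at most `x` goes right and one of index at least `x` goes left; the latter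
  -- precedes the former, so both have index `x`.
  have index_eq : ∀ x, x ∉ S → x ∉ T →
      (∃ p b, (ofLex p).1 = x ∧ f p = toLex (Sum.inr b)) ∧
      ∃ q a, (ofLex q).1 = x ∧ f q = toLex (Sum.inl a) := by
    intro x hxS hxT
    simp only [S, T, mem_ofPred_eq, not_forall] at hxS hxT
    obtain ⟨p, hpx, hp⟩ := hxS
    obtain ⟨q, hqx, hq⟩ := hxT
    obtain ⟨b, hb⟩ := (dich p).resolve_left hp
    obtain ⟨a, ha⟩ := (dich q).resolve_right hq
    have hqp := fst_le _ _ (mono q p a b ha hb)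
    exact ⟨⟨p, b, le_antisymm hpx (hqx.trans hqp), hb⟩, q, a, le_antisymm (hqp.trans hpx) hqx, ha⟩
  have aux : ∀ x y, x ∉ S → x ∉ T → y ∉ S → y ∉ T → y ≤ x := by
    intro x y hxS hxT hyS hyT
    obtain ⟨⟨p, b, rfl, hb⟩, -⟩ := index_eq x hxS hxT
    obtain ⟨-, q, a, rfl, ha⟩ := index_eq y hyS hyT
    exact fst_le _ _ (mono q p a b ha hb)
  have hST : (S ∪ T)ᶜ.Subsingleton := by
    intro x hx y hy
    simp only [mem_compl_iff, mem_union, not_or] at hx hy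
    exact le_antisymm (aux y x hy.1 hy.2 hx.1 hx.2) (aux x y hx.1 hx.2 hy.1 hy.2)
  obtain ⟨e, he, hle, h⟩ := hφ S T hS hT hST
  have g := fun x => (OrderType.le_iff_nonempty_toType.1 (hle x)).some
  have hf := f.strictMono.comp (Sigma.Lex.map_strictMono he g)
  exact h.imp
    (fun h => OrderType.le_of_strictMono_sum_inl hf fun p => h (ofLex p).1 _ le_rfl)
    (fun h => OrderType.le_of_strictMono_sum_inr hf fun p => h (ofLex p).1 _ le_rfl)

/-! ### Families of intervals in `ℚ` -/

theorem CutContainsIntervals.dual {L : Type v} [LinearOrder L] (hL : CutContainsIntervals L) :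
    CutContainsIntervals Lᵒᵈ := by
  intro S T hS hT hST
  obtain ⟨a, b, hab, hba, h⟩ := hL (OrderDual.toDual ⁻¹' T) (OrderDual.toDual ⁻¹' S)
    hT.toDual hS.toDual (fun x hx y hy => hST (fun h => hx h.symm) (fun h => hy h.symm))
  refine ⟨fun x => OrderDual.toDual (b (OrderDual.ofDual x)),
    fun x => OrderDual.toDual (a (OrderDual.ofDual x)), fun x => hab _,
    fun x y hxy => hba _ _ hxy, ?_⟩
  exact h.symm.imp (fun h x => (h _).symm) (fun h x => (h _).symm)

theorem exists_intervals_of_countable_of_dense {L : Type v} [LinearOrder L] [Countable L]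
    [DenselyOrdered L] {c d : L} (hcd : c < d) :
    ∃ a b : L → L, (∀ x, a x < b x) ∧ (∀ x y, x < y → b x ≤ a y) ∧
      ∀ x, a x ∈ Ioo c d ∧ b x ∈ Ioo c d := by
  have : Nontrivial (Ioo c d) := by
    obtain ⟨m, hcm, hmd⟩ := exists_between hcd
    obtain ⟨k, hmk, hkd⟩ := exists_between hmd
    exact ⟨⟨m, hcm, hmd⟩, ⟨k, hcm.trans hmk, hkd⟩, fun h => hmk.ne (congrArg Subtype.val h)⟩
  have : Countable (L ×ₗ Bool) := inferInstanceAs (Countable (L × Bool))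
  -- Doubling each point of `L` supplies both endpoints of its interval.
  obtain ⟨f⟩ := Order.embedding_from_countable_to_dense (L ×ₗ Bool) (Ioo c d)
  refine ⟨fun x => f (toLex (x, false)), fun x => f (toLex (x, true)), fun x => ?_,
    fun x y hxy => ?_, fun x => ⟨(f _).2, (f _).2⟩⟩
  · exact f.strictMono (Prod.Lex.toLex_lt_toLex.2 (Or.inr ⟨rfl, Bool.false_lt_true⟩))
  · exact (f.strictMono (Prod.Lex.toLex_lt_toLex.2 (Or.inl hxy))).le

theorem cutContainsIntervals_rat : CutContainsIntervals ℚ := by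
  intro S T hS hT hST
  obtain ⟨q, hq⟩ : ∃ q : ℚ, q ∈ S ∪ T := by
    by_contra! h
    exact zero_ne_one (hST (h 0) (h 1))
  rcases hq with hq | hq
  · obtain ⟨a, b, hab, hba, h⟩ := exists_intervals_of_countable_of_dense (sub_one_lt q)
    exact ⟨a, b, hab, hba, Or.inl fun x => ⟨hS (h x).1.2.le hq, hS (h x).2.2.le hq⟩⟩
  · obtain ⟨a, b, hab, hba, h⟩ := exists_intervals_of_countable_of_dense (lt_add_one q)
    exact ⟨a, b, hab, hba, Or.inr fun x => ⟨hT (h x).1.1.le hq, hT (h x).2.1.le hq⟩⟩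

/-! ### Families of intervals in a minimal Countryman line -/

theorem Set.exists_not_countable_inter_of_iUnion {α : Type*} {U : Set α} (hU : ¬ U.Countable)
    {P : ℕ → Set α} (hP : U ⊆ ⋃ n, P n) : ∃ n, ¬ (U ∩ P n).Countable := by
  by_contra! h
  refine hU ((countable_iUnion h).mono fun x hx => ?_)
  obtain ⟨n, hn⟩ := mem_iUnion.1 (hP hx)
  exact mem_iUnion.2 ⟨n, hx, hn⟩

theorem Set.exists_lt_of_not_countable {α : Type*} [LinearOrder α] {U : Set α}
    (hU : ¬ U.Countable) : ∃ x ∈ U, ∃ y ∈ U, x < y := by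
  by_contra! h
  exact hU (Set.Subsingleton.countable fun x hx y hy => le_antisymm (h y hy x hx) (h x hx y hy))

theorem IsAronszajnLine.not_countable_univ {A : Type u} [LinearOrder A] (hA : IsAronszajnLine A) :
    ¬ (univ : Set A).Countable := by
  rw [← le_aleph0_iff_set_countable, mk_univ, hA.card_eq, not_le]
  exact aleph0_lt_aleph_one

theorem IsAronszajnLine.subtype {A : Type u} [LinearOrder A] (hA : IsAronszajnLine A) {X : Set A}
    (hX : ¬ X.Countable) : IsAronszajnLine X where
  card_eq := by
    refine le_antisymm (hA.card_eq ▸ mk_set_le X) ?_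
    rwa [← le_aleph0_iff_set_countable, not_le, ← aleph_one_le_iff] at hX
  countable_of_real := by
    rintro S ⟨f⟩
    refine countable_of_injective_of_countable_image Subtype.val_injective.injOn
      (hA.countable_of_real (Subtype.val '' S) ⟨?_⟩)
    have hmem : ∀ y : Subtype.val '' S, ∃ x : S, ((x : X) : A) = y := by
      rintro ⟨_, x, hx, rfl⟩
      exact ⟨⟨x, hx⟩, rfl⟩
    choose g hg using hmem
    refine OrderEmbedding.ofStrictMono (fun y => f (g y)) fun y z hyz => f.strictMono ?_
    rw [← Subtype.coe_lt_coe, ← Subtype.coe_lt_coe, hg, hg]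
    exact hyz
  no_omega_one := ⟨fun f => hA.no_omega_one.false (f.trans (OrderEmbedding.subtype _))⟩
  no_omega_one_dual := ⟨fun f => hA.no_omega_one_dual.false (f.trans (OrderEmbedding.subtype _))⟩

/-- One of the countably many chains would contain uncountably many points of the graph of a
decreasing map, but no two such points are comparable. -/
theorem IsCountrymanLine.isEmpty_dual_embedding {C : Type u} [LinearOrder C]
    (hC : IsCountrymanLine C) : IsEmpty (Cᵒᵈ ↪o C) := by
  refine ⟨fun f => ?_⟩
  obtain ⟨K, hK, hcov⟩ := hC.square
  obtain ⟨n, hn⟩ := exists_not_countable_inter_of_iUnion hC.aronszajn.not_countable_univ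
    (P := fun n => {x : C | (x, f (OrderDual.toDual x)) ∈ K n}) fun x _ => by
      obtain ⟨n, hn⟩ := mem_iUnion.1 (hcov ▸ mem_univ (x, f (OrderDual.toDual x)))
      exact mem_iUnion.2 ⟨n, hn⟩
  obtain ⟨x, ⟨-, hx⟩, y, ⟨-, hy⟩, hxy⟩ := exists_lt_of_not_countable hn
  have hf : f (OrderDual.toDual y) < f (OrderDual.toDual x) :=
    f.strictMono (OrderDual.toDual_lt_toDual.2 hxy)
  rcases hK n hx hy (fun h => hxy.ne (congrArg Prod.fst h)) with h | h
  · exact hf.not_ge h.2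
  · exact hxy.not_ge h.1

theorem IsMinimalCountrymanLine.nonempty_embedding_subtype {C : Type u} [LinearOrder C]
    (hC : IsMinimalCountrymanLine C) {X : Set C} (hX : ¬ X.Countable) : Nonempty (C ↪o X) :=
  (hC.minimal X (hC.countryman.aronszajn.subtype hX)).resolve_right fun ⟨f⟩ =>
    hC.countryman.isEmpty_dual_embedding.false (f.trans (OrderEmbedding.subtype _))

/-- Each `x` has uncountably many `y ∈ U` with `(x, y)` in a single chain, and one chain `K k`
serves uncountably many `x`, among which lies a copy of `C`. In a chain, the fibre over a smaller
point lies weakly below the fibre over a larger one, so two points of each fibre serve as endpoints.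
-/
theorem IsMinimalCountrymanLine.exists_intervals {C : Type u} [LinearOrder C]
    (hC : IsMinimalCountrymanLine C) {U : Set C} (hU : ¬ U.Countable) :
    ∃ a b : C → C, (∀ x, a x < b x) ∧ (∀ x y, x < y → b x ≤ a y) ∧ ∀ x, a x ∈ U ∧ b x ∈ U := by
  obtain ⟨K, hK, hcov⟩ := hC.countryman.square
  have hfib : ∀ x : C, ∃ n, ¬ (U ∩ {y | (x, y) ∈ K n}).Countable := fun x =>
    exists_not_countable_inter_of_iUnion hU fun y _ => by
      obtain ⟨n, hn⟩ := mem_iUnion.1 (hcov ▸ mem_univ (x, y))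
      exact mem_iUnion.2 ⟨n, hn⟩
  choose n hn using hfib
  obtain ⟨k, hk⟩ := exists_not_countable_inter_of_iUnion
    hC.countryman.aronszajn.not_countable_univ (P := fun k => {x | n x = k})
    fun x _ => mem_iUnion.2 ⟨n x, rfl⟩
  obtain ⟨e⟩ := hC.nonempty_embedding_subtype hk
  choose a ha b hb hab using fun x => exists_lt_of_not_countable (hn (e x))
  refine ⟨a, b, hab, fun x y hxy => ?_, fun x => ⟨(ha x).1, (hb x).1⟩⟩
  have hexy : (e x : C) < e y := e.strictMono hxy
  have hnk : ∀ z, n (e z) = k := fun z => (e z).2.2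
  have hx : ((e x : C), b x) ∈ K k := by simpa only [hnk, mem_ofPred_eq] using (hb x).2
  have hy : ((e y : C), a y) ∈ K k := by simpa only [hnk, mem_ofPred_eq] using (ha y).2
  rcases hK k hx hy (fun h => hexy.ne (congrArg Prod.fst h)) with h | h
  · exact h.2
  · exact absurd h.1 hexy.not_ge

theorem IsMinimalCountrymanLine.cutContainsIntervals {C : Type u} [LinearOrder C]
    (hC : IsMinimalCountrymanLine C) : CutContainsIntervals C := by
  intro S T _ _ hST
  by_cases hS : S.Countable
  · by_cases hT : T.Countable
    · refine absurd ?_ hC.countryman.aronszajn.not_countable_univ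
      rw [← union_compl_self (S ∪ T)]
      exact (hS.union hT).union hST.countable
    · obtain ⟨a, b, hab, hba, h⟩ := hC.exists_intervals hT
      exact ⟨a, b, hab, hba, Or.inr h⟩
  · obtain ⟨a, b, hab, hba, h⟩ := hC.exists_intervals hS
    exact ⟨a, b, hab, hba, Or.inl h⟩

/-! ### Unbounded sums over `ω` and `ω*` -/

theorem IsUnboundedSeq.exists_strictMono {φ : ℕ → OrderType.{u}} (hφ : IsUnboundedSeq φ) (N : ℕ) :
    ∃ e : ℕ → ℕ, StrictMono e ∧ (∀ n, φ n ≤ φ (e n)) ∧ ∀ n, N ≤ e n := by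
  -- Iterating unboundedness passes any bound `k`, so `e` can be built greedily from `N`.
  have h : ∀ n k, ∃ m, k < m ∧ φ n ≤ φ m := by
    intro n k
    induction k with
    | zero =>
      obtain ⟨m, hm, hle⟩ := hφ n
      exact ⟨m, by omega, hle⟩
    | succ k ih =>
      obtain ⟨m, hm, hle⟩ := ih
      obtain ⟨l, hl, hle'⟩ := hφ m
      exact ⟨l, by omega, hle.trans hle'⟩
  choose g hg hle using h
  let e : ℕ → ℕ := fun n => Nat.rec (g 0 N) (fun n m => g (n + 1) m) n
  have he : StrictMono e := strictMono_nat_of_lt_succ fun n => hg (n + 1) (e n)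
  refine ⟨e, he, fun n => ?_, fun n => (hg 0 N).le.trans (he.monotone n.zero_le)⟩
  cases n with
  | zero => exact hle 0 N
  | succ n => exact hle (n + 1) (e n)

theorem IsUnboundedSeq.exists_strictMono_of_cut {φ : ℕ → OrderType.{u}} (hφ : IsUnboundedSeq φ)
    {S T : Set ℕ} (hS : IsLowerSet S) (hT : IsUpperSet T) (hST : (S ∪ T)ᶜ.Subsingleton) :
    ∃ e : ℕ → ℕ, StrictMono e ∧ (∀ n, φ n ≤ φ (e n)) ∧ ((∀ n, e n ∈ S) ∨ ∀ n, e n ∈ T) := by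
  rcases T.eq_empty_or_nonempty with rfl | ⟨N, hN⟩
  -- A lower set missing `n` also misses `n + 1`, so here `S` is all of `ℕ`.
  · rw [union_empty] at hST
    refine ⟨id, strictMono_id, fun n => le_rfl, Or.inl fun n => ?_⟩
    by_contra hn
    exact n.succ_ne_self (hST (fun h => hn (hS n.le_succ h)) hn)
  · obtain ⟨e, he, hle, h⟩ := hφ.exists_strictMono N
    exact ⟨e, he, hle, Or.inr fun n => hT (h n) hN⟩

theorem IsUnboundedSeq.cutAbsorbing {φ : ℕ → OrderType.{u}} (hφ : IsUnboundedSeq φ) :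
    CutAbsorbing φ :=
  fun _ _ hS hT hST => hφ.exists_strictMono_of_cut hS hT hST

theorem IsUnboundedSeq.cutAbsorbing_dual {φ : ℕ → OrderType.{u}} (hφ : IsUnboundedSeq φ) :
    CutAbsorbing fun k : ℕᵒᵈ => φ (OrderDual.ofDual k) := by
  intro S T hS hT hST
  obtain ⟨e, he, hle, h⟩ := hφ.exists_strictMono_of_cut (S := OrderDual.toDual ⁻¹' T)
    (T := OrderDual.toDual ⁻¹' S) hT.toDual hS.toDual
    (fun x hx y hy => hST (fun h => hx h.symm) (fun h => hy h.symm))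
  refine ⟨fun k => OrderDual.toDual (e (OrderDual.ofDual k)), fun x y hxy => he hxy,
    fun x => hle _, ?_⟩
  exact h.symm.imp (fun h x => h _) (fun h x => h _)

theorem algIndecomposable_zero : AlgIndecomposable (OrderType.type PEmpty.{u + 1}) :=
  fun ψ _ _ => Or.inl (OrderType.type_of_isEmpty.trans_le (OrderType.zero_le ψ))

theorem algIndecomposable_one : AlgIndecomposable (OrderType.type PUnit.{u + 1}) := by
  intro ψ₁ ψ₂ ⟨h, _⟩
  rw [← OrderType.type_toType ψ₁, ← OrderType.type_toType ψ₂] at h ⊢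
  rw [← OrderType.type_lex_sum] at h
  obtain ⟨f⟩ := OrderType.type_le_type_iff.1 h
  rcases hp : ofLex (f PUnit.unit) with a | b
  · exact Or.inl (OrderType.le_of_strictMono_sum_inl f.strictMono fun _ => ⟨a, hp⟩)
  · exact Or.inr (OrderType.le_of_strictMono_sum_inr f.strictMono fun _ => ⟨b, hp⟩)

theorem proposition1 {C : Type u} [LinearOrder C] (hC : IsMinimalCountrymanLine C)
    (φ : OrderType.{u}) (hφ : φ ∈ classH C) : AlgIndecomposable φ := by
  obtain ⟨β, h⟩ := hφ
  cases h with
  | zero => exact algIndecomposable_zero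
  | one => exact algIndecomposable_one
  | shuffleRat _ _ _ _ _ hs => exact (hs.cutAbsorbing cutContainsIntervals_rat).algIndecomposable
  | shuffleC _ _ _ _ _ hs => exact (hs.cutAbsorbing hC.cutContainsIntervals).algIndecomposable
  | shuffleCDual _ _ _ _ _ hs =>
    exact (hs.cutAbsorbing hC.cutContainsIntervals.dual).algIndecomposable
  | sumOmega _ _ _ _ _ hu => exact hu.cutAbsorbing.algIndecomposable
  | sumOmegaDual _ _ _ _ _ hu => exact hu.cutAbsorbing_dual.algIndecomposable
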